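/- Let $d$ and $N$ be nonnegative integers. A lattice $d$-polytope is a $d$-dimensional polytope $P\subset\mathbb{R}^d$ (the convex hull of a finite set of points) all of whose vertices lie in $\mathbb{Z}^d$. Two vertices $v\neq w$ of $P$ are adjacent if the segment $[v,w]$ is an edge of $P$. A lattice $d$-polytope $P$ is called smooth if every vertex $v$ of $P$ has exactly $d$ adjacent vertices $w_1,\dots,w_d$ and the primitive edge directions $\frac{w_i-v}{\gcd(w_i-v)}$, $i=1,\dots,d$, form a basis of $\mathbb{Z}^d$, i.e. $\det\Big(\frac{w_1-v}{\gcd(w_1-v)},\dots,\frac{w_d-v}{\gcd(w_d-v)}\Big)=\pm1$ (here $\gcd(z)$ is the greatest common divisor of the coordinates of $z$). Two subsets $P,Q\subset\mathbb{R}^d$ are lattice equivalent if $Q=UP+t$ for some $U\in GL_d(\mathbb{Z})$ and $t\in\mathbb{Z}^d$. Theorem (Finiteness). Up to lattice equivalence, there are only finitely many smooth lattice $d$-polytopes $P\subset\mathbb{R}^d$ with $|P\cap\mathbb{Z}^d|\le N$. -/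

import Mathlib

noncomputable section

namespace SmoothPolytope

/-- The inclusion of the lattice `ℤ^d` into `ℝ^d`. -/
def toReal {d : ℕ} (z : Fin d → ℤ) : Fin d → ℝ := fun i => (z i : ℝ)

/-- A polytope is the convex hull of a finite set of points. -/
def IsPolytope {d : ℕ} (P : Set (Fin d → ℝ)) : Prop :=
  ∃ V : Set (Fin d → ℝ), V.Finite ∧ P = convexHull ℝ V

/-- The vertices of a polytope, as its extreme points (this is the unique inclusion-minimal
finite set whose convex hull is the polytope). -/
def vertices {d : ℕ} (P : Set (Fin d → ℝ)) : Set (Fin d → ℝ) :=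
  P.extremePoints ℝ

/-- A lattice polytope: all vertices have integer coordinates. -/
def IsLatticePolytope {d : ℕ} (P : Set (Fin d → ℝ)) : Prop :=
  IsPolytope P ∧ ∀ v ∈ vertices P, ∃ z : Fin d → ℤ, v = toReal z

/-- The lattice points of `P`, that is, `P ∩ ℤ^d`. -/
def latticePoints {d : ℕ} (P : Set (Fin d → ℝ)) : Set (Fin d → ℝ) :=
  P ∩ Set.range toReal

/-- The vertices adjacent to `v`: those `w ≠ v` such that the segment from `v` to `w` is an
edge. The (nonempty) faces of a polytope are its exposed subsets, that is, the sets of maximizers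
of a linear functional. -/
def neighbors {d : ℕ} (P : Set (Fin d → ℝ)) (v : Fin d → ℝ) : Set (Fin d → ℝ) :=
  {w | w ∈ vertices P ∧ w ≠ v ∧ IsExposed ℝ P (segment ℝ v w)}

/-- A polytope in `ℝ^d` is simple if each vertex has exactly `d` neighbours. -/
def IsSimple {d : ℕ} (P : Set (Fin d → ℝ)) : Prop :=
  ∀ v ∈ vertices P, (neighbors P v).encard = d

/-- The vector `z / gcd(z)`. -/
def primitive {d : ℕ} (z : Fin d → ℤ) : Fin d → ℤ :=
  fun i => z i / Finset.univ.gcd z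

/-- A smooth `d`-polytope in `ℝ^d`: a full-dimensional simple lattice polytope such that, at each
vertex `v`, listing the neighbours as `w 0, …, w (d - 1)`, the matrix with rows
`(w i - v) / gcd (w i - v)` has determinant `±1` (up to sign the determinant does not depend on the
order of the list). -/
def IsSmoothPolytope {d : ℕ} (P : Set (Fin d → ℝ)) : Prop :=
  IsLatticePolytope P ∧ affineSpan ℝ P = ⊤ ∧ IsSimple P ∧
    ∀ v : Fin d → ℤ, toReal v ∈ vertices P →
      ∃ w : Fin d → (Fin d → ℤ), Function.Injective w ∧
        Set.range (fun i => toReal (w i)) = neighbors P (toReal v) ∧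
        ((Matrix.of fun i => primitive (w i - v)).det = 1 ∨
          (Matrix.of fun i => primitive (w i - v)).det = -1)

/-- The affine lattice transformation `x ↦ U x + t` of `ℝ^d`, where `U ∈ GL_d(ℤ)` and
`t ∈ ℤ^d`. -/
def latticeMap {d : ℕ} (U : GL (Fin d) ℤ) (t : Fin d → ℤ) (x : Fin d → ℝ) : Fin d → ℝ :=
  Matrix.mulVec ((U : Matrix (Fin d) (Fin d) ℤ).map (Int.cast : ℤ → ℝ)) x + toReal t

/-- Lattice equivalence (lattice isomorphism) of subsets of `ℝ^d`. -/
def LatticeEquivalent {d : ℕ} (P Q : Set (Fin d → ℝ)) : Prop :=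
  ∃ (U : GL (Fin d) ℤ) (t : Fin d → ℤ), Q = latticeMap U t '' P

theorem latticeMap_one {d : ℕ} (x : Fin d → ℝ) : latticeMap 1 0 x = x := by
  ext i
  simp [latticeMap, toReal, Matrix.map_one]

theorem latticeMap_comp {d : ℕ} (U U' : GL (Fin d) ℤ) (t t' : Fin d → ℤ) (x : Fin d → ℝ) :
    latticeMap U' t' (latticeMap U t x) =
      latticeMap (U' * U) (Matrix.mulVec (U' : Matrix (Fin d) (Fin d) ℤ) t + t') x := by
  have h : (((U' * U : GL (Fin d) ℤ) : Matrix (Fin d) (Fin d) ℤ).map (Int.cast : ℤ → ℝ)) =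
      ((U' : Matrix (Fin d) (Fin d) ℤ).map (Int.cast : ℤ → ℝ)) *
        ((U : Matrix (Fin d) (Fin d) ℤ).map (Int.cast : ℤ → ℝ)) := by
    ext i j
    simp [Matrix.mul_apply]
  unfold latticeMap
  rw [h, Matrix.mulVec_add, Matrix.mulVec_mulVec, add_assoc]
  congr 1
  ext i
  simp [toReal, Matrix.mulVec, dotProduct]

/-- Lattice equivalence is an equivalence relation. -/
def latticeSetoid (d : ℕ) : Setoid (Set (Fin d → ℝ)) where
  r := LatticeEquivalent
  iseqv := by
    refine ⟨fun P => ⟨1, 0, ?_⟩, ?_, ?_⟩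
    · have h : latticeMap (1 : GL (Fin d) ℤ) 0 = id := funext latticeMap_one
      rw [h, Set.image_id]
    · rintro P Q ⟨U, t, rfl⟩
      refine ⟨U⁻¹, -Matrix.mulVec ((U⁻¹ : GL (Fin d) ℤ) : Matrix (Fin d) (Fin d) ℤ) t, ?_⟩
      rw [Set.image_image]
      simp only [latticeMap_comp, inv_mul_cancel, add_neg_cancel, latticeMap_one, Set.image_id']
    · rintro P Q R ⟨U, t, rfl⟩ ⟨U', t', rfl⟩
      refine ⟨U' * U, Matrix.mulVec (U' : Matrix (Fin d) (Fin d) ℤ) t + t', ?_⟩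
      rw [Set.image_image]
      simp only [latticeMap_comp]

end SmoothPolytope

end

/-!
A smooth polytope is determined, up to lattice equivalence, by the coordinates of its vertices in
the lattice basis formed by the primitive edge directions at one of them. These coordinates are
bounded in terms of the number `N` of lattice points alone; since a box contains finitely many sets
of lattice points, finiteness follows
(`exists_latticeEquivalent_convexHull`).

The bound is obtained by walking along edges. If `v` and `w = v + l • b` are the ends of an edge
with primitive direction `b`, then the cones of the polytope at `v` and at `w` become equal modulo
`b`, and both are spanned by part of a lattice basis; hence every other primitive direction `b'` at
`w` has the form `c + a • b` with `c` a primitive direction at `v` (`exists_row_eq_add_smul`). The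
polytope contains the segment from `v + c` to `w + b' = v + c + (l + a) • b`. By convexity at `v`
the number `l + a` is nonnegative, and the segment contains `l + a + 1` lattice points, as the edge
itself contains `l + 1`; therefore `|a| ≤ N` (`IsVertexFrame.exists_row_eq`). So each step along an
edge multiplies the coordinates of the frame by at most `1 + N`. Any vertex is reached in at most
`N` steps by following edges that increase a linear functional it maximizes (`abs_apply_sub_le`).

Both the comparison of cones and the existence of an increasing edge rest on the fact that a
polytope lies in the cone spanned by the edges through any of its vertices
(`IsPolytope.sub_mem_hull_neighbors`).
-/

namespace SmoothPolytope

/-! ### Vertices and edges of polytopes -/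

section Polytope

variable {d : ℕ} {P : Set (Fin d → ℝ)}

theorem IsPolytope.finite_vertices (hP : IsPolytope P) : (vertices P).Finite := by
  obtain ⟨V, hV, rfl⟩ := hP
  exact hV.subset extremePoints_convexHull_subset

theorem IsPolytope.convex (hP : IsPolytope P) : Convex ℝ P := by
  obtain ⟨V, hV, rfl⟩ := hP
  exact convex_convexHull ℝ V

theorem IsPolytope.isCompact (hP : IsPolytope P) : IsCompact P := by
  obtain ⟨V, hV, rfl⟩ := hP
  exact hV.isCompact_convexHull ℝ

theorem IsPolytope.convexHull_vertices (hP : IsPolytope P) : convexHull ℝ (vertices P) = P := by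
  rw [← (hP.finite_vertices.isCompact_convexHull ℝ).isClosed.closure_eq]
  exact closure_convexHull_extremePoints hP.isCompact hP.convex

/-- Every vertex of a polytope is the unique maximizer of some linear functional. -/
theorem IsPolytope.exists_forall_lt (hP : IsPolytope P) {v : Fin d → ℝ} (hv : v ∈ vertices P) :
    ∃ f : StrongDual ℝ (Fin d → ℝ), ∀ x ∈ vertices P, x ≠ v → f x < f v := by
  have hfin : (vertices P \ {v}).Finite := hP.finite_vertices.subset Set.sdiff_subset
  have hnot : v ∉ convexHull ℝ (vertices P \ {v}) := by
    intro hmem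
    have hsub : convexHull ℝ (vertices P \ {v}) ⊆ P :=
      convexHull_min (Set.sdiff_subset.trans extremePoints_subset) hP.convex
    exact (extremePoints_convexHull_subset
      (inter_extremePoints_subset_extremePoints_of_subset hsub ⟨hmem, hv⟩)).2 rfl
  obtain ⟨f, u, hf, hu⟩ := geometric_hahn_banach_closed_point (convex_convexHull ℝ _)
    (hfin.isCompact_convexHull ℝ).isClosed hnot
  exact ⟨f, fun x hx hxv => (hf x (subset_convexHull ℝ _ ⟨hx, hxv⟩)).trans hu⟩

/-- Among the vertices other than `v`, those in a minimal set spanning the cone of `P` at `v` are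
neighbours of `v`, so the cone of `P` at `v` is spanned by the edges through `v`. -/
theorem IsPolytope.sub_mem_hull_neighbors (hP : IsPolytope P) {v : Fin d → ℝ}
    (hv : v ∈ vertices P) {x : Fin d → ℝ} (hx : x ∈ P) :
    x - v ∈ PointedCone.hull ℝ ((· - v) '' neighbors P v) := by
  have hfin : (vertices P \ {v}).Finite := hP.finite_vertices.subset Set.sdiff_subset
  let F : Set (Set (Fin d → ℝ)) := {S | S ⊆ vertices P \ {v} ∧
    ∀ x ∈ vertices P \ {v}, x - v ∈ PointedCone.hull ℝ ((· - v) '' S)}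
  have hF : F.Finite := hfin.finite_subsets.subset fun S hS => hS.1
  obtain ⟨S, hS⟩ := hF.exists_minimal
    ⟨_, subset_rfl, fun x hx => PointedCone.subset_hull ⟨x, hx, rfl⟩⟩
  have hSV := hS.prop.1
  have hPS : ∀ x ∈ P, x - v ∈ PointedCone.hull ℝ ((· - v) '' S) := by
    intro x hx
    rw [← hP.convexHull_vertices] at hx
    have hconv : Convex ℝ
        ((· + -v) ⁻¹' (PointedCone.hull ℝ ((· - v) '' S) : Set (Fin d → ℝ))) :=
      (PointedCone.convex _).translate_preimage_left (-v)
    have := convexHull_min (fun y hy => ?_) hconv hx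
    · simpa [sub_eq_add_neg] using this
    · by_cases hyv : y = v
      · simp [hyv]
      · simpa [sub_eq_add_neg] using hS.prop.2 y ⟨hy, hyv⟩
  suffices hSn : S ⊆ neighbors P v from
    Submodule.span_mono (Set.image_mono hSn) (hPS x hx)
  intro s hs
  obtain ⟨f, hf⟩ := hP.exists_forall_lt hv
  have hsv : s ≠ v := (hSV hs).2
  have hirr : s - v ∉ PointedCone.hull ℝ ((· - v) '' (S \ {s})) := by
    intro hmem
    have hle : PointedCone.hull ℝ ((· - v) '' S) ≤
        PointedCone.hull ℝ ((· - v) '' (S \ {s})) := by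
      refine Submodule.span_le.2 ?_
      rintro _ ⟨y, hy, rfl⟩
      by_cases hys : y = s
      · rw [hys]; exact hmem
      · exact PointedCone.subset_hull ⟨y, ⟨hy, hys⟩, rfl⟩
    have hsub := hS.le_of_le (y := S \ {s})
      ⟨Set.sdiff_subset.trans hSV, fun y hy => hle (hS.prop.2 y hy)⟩ Set.sdiff_subset
    exact (hsub hs).2 rfl
  have hKfin : ((· - v) '' (S \ {s})).Finite :=
    (hfin.subset (Set.sdiff_subset.trans hSV)).image _
  have hdisj : Disjoint (convexHull ℝ ((· - v) '' (S \ {s})))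
      (Submodule.span ℝ {s - v} : Set (Fin d → ℝ)) := by
    rw [Set.disjoint_left]
    intro y hy hyL
    obtain ⟨t, rfl⟩ := Submodule.mem_span_singleton.1 hyL
    have hneg : f (t • (s - v)) < 0 := by
      have hcv : Convex ℝ {y | f y < 0} := convex_halfSpace_lt f.isLinear 0
      refine convexHull_min ?_ hcv hy
      rintro _ ⟨z, hz, rfl⟩
      have := hf z (hSV hz.1).1 (hSV hz.1).2
      simpa using this
    have hsneg : f (s - v) < 0 := by simpa using hf s (hSV hs).1 hsv
    have ht : 0 < t := by
      rw [map_smul, smul_eq_mul] at hneg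
      by_contra! ht
      nlinarith
    have hmem := convexHull_min (PointedCone.subset_hull (R := ℝ)) (PointedCone.convex _) hy
    exact hirr (((PointedCone.hull ℝ _).smul_mem_iff ht).1 hmem)
  obtain ⟨g, u, w, hgu, huw, hgw⟩ := geometric_hahn_banach_compact_closed (convex_convexHull ℝ _)
    (hKfin.isCompact_convexHull ℝ) (Submodule.convex _)
    (Submodule.closed_of_finiteDimensional (Submodule.span ℝ {s - v})) hdisj
  have hw : w < 0 := by simpa using hgw 0 (Submodule.zero_mem _)
  -- a functional bounded below on a line vanishes there
  have hgs : g (s - v) = 0 := by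
    by_contra hne
    have := hgw ((w / g (s - v)) • (s - v)) (Submodule.mem_span_singleton.2 ⟨_, rfl⟩)
    rw [map_smul, smul_eq_mul, div_mul_cancel₀ _ hne] at this
    exact lt_irrefl _ this
  have hcone : ∀ y ∈ PointedCone.hull ℝ ((· - v) '' S),
      g y ≤ 0 ∧ (g y = 0 → ∃ t : ℝ, 0 ≤ t ∧ y = t • (s - v)) := by
    intro y hy
    induction hy using Submodule.span_induction with
    | mem y hy =>
      obtain ⟨z, hz, rfl⟩ := hy
      by_cases hzs : z = s
      · subst hzs
        exact ⟨hgs.le, fun _ => ⟨1, zero_le_one, by simp⟩⟩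
      · have := hgu (z - v) (subset_convexHull ℝ _ ⟨z, ⟨hz, hzs⟩, rfl⟩)
        exact ⟨by linarith, fun h0 => by linarith⟩
    | zero => exact ⟨by simp, fun _ => ⟨0, le_rfl, by simp⟩⟩
    | add a b _ _ ha hb =>
      rw [map_add]
      refine ⟨by linarith [ha.1, hb.1], fun h0 => ?_⟩
      obtain ⟨t, ht, hta⟩ := ha.2 (by linarith [ha.1, hb.1])
      obtain ⟨r, hr, hrb⟩ := hb.2 (by linarith [ha.1, hb.1])
      exact ⟨t + r, by positivity, by rw [hta, hrb, add_smul]⟩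
    | smul c a _ ha =>
      have hca : c • a = (c : ℝ) • a := rfl
      have hc : (0 : ℝ) ≤ c := c.2
      rw [hca, map_smul, smul_eq_mul]
      refine ⟨mul_nonpos_of_nonneg_of_nonpos hc ha.1, fun h0 => ?_⟩
      rcases mul_eq_zero.1 h0 with h | h
      · exact ⟨0, le_rfl, by rw [h]; simp⟩
      · obtain ⟨t, ht, hta⟩ := ha.2 h
        exact ⟨c * t, by positivity, by rw [hta, mul_smul]⟩
  have hgP : ∀ y ∈ P, g y ≤ g v := fun y hy => by
    simpa using (hcone _ (hPS y hy)).1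
  refine ⟨(hSV hs).1, hsv, fun _ => ⟨g, ?_⟩⟩
  have hvP : v ∈ P := extremePoints_subset hv
  have hsP : s ∈ P := extremePoints_subset (hSV hs).1
  have hgsv : g s = g v := by simpa [sub_eq_zero] using hgs
  ext y
  constructor
  · intro hy
    refine ⟨hP.convex.segment_subset hvP hsP hy, fun z hz => ?_⟩
    obtain ⟨a, b, _, _, hab, rfl⟩ := hy
    have : g (a • v + b • s) = g v := by
      simp only [map_add, map_smul, hgsv, smul_eq_mul]
      rw [← add_mul, hab, one_mul]
    rw [this]
    exact hgP z hz
  · rintro ⟨hyP, hy⟩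
    have hgy : g (y - v) = 0 := by
      rw [map_sub, sub_eq_zero]
      exact le_antisymm (hgP y hyP) (hy v hvP)
    obtain ⟨t, ht, hyt⟩ := (hcone _ (hPS y hyP)).2 hgy
    have hy' : y = v + t • (s - v) := by rw [← hyt]; abel
    rcases le_or_gt t 1 with h1 | h1
    · rw [segment_eq_image']
      exact ⟨t, ⟨ht, h1⟩, hy'.symm⟩
    · -- beyond `s` the ray leaves `P`, because `s` is extreme
      have hmem : s ∈ openSegment ℝ v y := by
        rw [openSegment_eq_image']
        refine ⟨t⁻¹, ⟨by positivity, inv_lt_one_of_one_lt₀ h1⟩, ?_⟩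
        have ht0 : t ≠ 0 := by positivity
        simp [hyt, smul_smul, ht0]
      exact absurd ((hSV hs).1.2 hvP hyP hmem).symm hsv

/-- A vertex of a polytope that is a local maximum of a linear functional along the edges is a
global one. -/
theorem IsPolytope.le_of_forall_neighbors_le (hP : IsPolytope P) {v : Fin d → ℝ}
    (hv : v ∈ vertices P) (f : (Fin d → ℝ) →ₗ[ℝ] ℝ) (hf : ∀ w ∈ neighbors P v, f w ≤ f v)
    {x : Fin d → ℝ} (hx : x ∈ P) : f x ≤ f v := by
  suffices h : ∀ y ∈ PointedCone.hull ℝ ((· - v) '' neighbors P v), f y ≤ 0 by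
    simpa using h _ (hP.sub_mem_hull_neighbors hv hx)
  intro y hy
  induction hy using Submodule.span_induction with
  | mem y hy =>
    obtain ⟨z, hz, rfl⟩ := hy
    simpa using hf z hz
  | zero => simp
  | add a b _ _ ha hb => rw [map_add]; linarith
  | smul c a _ ha =>
    have hca : c • a = (c : ℝ) • a := rfl
    rw [hca, map_smul, smul_eq_mul]
    exact mul_nonpos_of_nonneg_of_nonpos c.2 ha

theorem mem_neighbors_symm {v w : Fin d → ℝ} (hv : v ∈ vertices P) (hw : w ∈ neighbors P v) :
    v ∈ neighbors P w :=
  ⟨hv, hw.2.1.symm, segment_symm ℝ v w ▸ hw.2.2⟩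

end Polytope

/-! ### Lattice points and integral frames -/

section Lattice

variable {d : ℕ} {P : Set (Fin d → ℝ)}

theorem toReal_injective : Function.Injective (toReal : (Fin d → ℤ) → Fin d → ℝ) :=
  fun x y h => funext fun i => by simpa [toReal] using congrFun h i

theorem toReal_add (x y : Fin d → ℤ) : toReal (x + y) = toReal x + toReal y := by
  ext i; simp [toReal]

theorem toReal_zsmul (n : ℤ) (x : Fin d → ℤ) : toReal (n • x) = (n : ℝ) • toReal x := by
  ext i; simp [toReal]

theorem toReal_add_zsmul_mem (hP : Convex ℝ P) {x b : Fin d → ℤ} {m n : ℤ} (hm : 0 ≤ m)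
    (hmn : m ≤ n) (hx : toReal x ∈ P) (hy : toReal (x + n • b) ∈ P) :
    toReal (x + m • b) ∈ P := by
  rcases hm.eq_or_lt with rfl | hm
  · simpa using hx
  have hn : (0 : ℝ) < n := by exact_mod_cast hm.trans_le hmn
  have hmn' : (m : ℝ) ≤ n := by exact_mod_cast hmn
  have h := hP.add_smul_sub_mem hx hy (t := (m : ℝ) / n)
    ⟨by positivity, (div_le_one hn).2 hmn'⟩
  convert h using 1
  rw [toReal_add, toReal_add, toReal_zsmul, toReal_zsmul, add_sub_cancel_left, smul_smul,
    div_mul_cancel₀ _ hn.ne']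

/-- A lattice segment of lattice length `n` inside `P` contributes `n + 1` lattice points. -/
theorem succ_le_of_segment (hP : Convex ℝ P) {N : ℕ}
    (hN : (latticePoints P).encard ≤ (N : ℕ∞)) {x b : Fin d → ℤ} {n : ℤ} (hn : 0 ≤ n)
    (hb : b ≠ 0) (hx : toReal x ∈ P) (hy : toReal (x + n • b) ∈ P) : n + 1 ≤ N := by
  have hinj : Function.Injective fun m : ℤ => toReal (x + m • b) := by
    intro m m' h
    have h' : m • b = m' • b := add_left_cancel (toReal_injective h)
    exact smul_left_injective ℤ hb h'
  have hsub : (fun m : ℤ => toReal (x + m • b)) '' (Finset.Icc 0 n : Finset ℤ) ⊆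
      latticePoints P := by
    rintro _ ⟨m, hm, rfl⟩
    rw [Finset.mem_coe, Finset.mem_Icc] at hm
    exact ⟨toReal_add_zsmul_mem hP hm.1 hm.2 hx hy, _, rfl⟩
  have h := (Set.encard_le_encard hsub).trans hN
  rw [hinj.encard_image, Set.encard_coe_eq_coe_finsetCard, Int.card_Icc] at h
  have h' : (n + 1 - 0).toNat ≤ N := by exact_mod_cast h
  omega

/-- The functional sending a vector to its `i`-th coordinate in the basis formed by the rows of
the inverse of the matrix `A`. -/
def coordFunctional (A : Matrix (Fin d) (Fin d) ℤ) (i : Fin d) : (Fin d → ℝ) →ₗ[ℝ] ℝ :=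
  LinearMap.proj i ∘ₗ (A.map (Int.cast : ℤ → ℝ)).vecMulLinear

theorem coordFunctional_toReal (A : Matrix (Fin d) (Fin d) ℤ) (i : Fin d) (z : Fin d → ℤ) :
    coordFunctional A i (toReal z) = ((Matrix.vecMul z A i : ℤ) : ℝ) := by
  simp [coordFunctional, toReal, Matrix.vecMul, dotProduct]

/-- The local structure of a smooth polytope at a vertex `v`: the rows of `B` form a basis of
`ℤ^d`, and the neighbours of `v` are the points `v + l i • B i`. -/
structure IsVertexFrame (P : Set (Fin d → ℝ)) (v : Fin d → ℤ) (B : Matrix (Fin d) (Fin d) ℤ)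
    (l : Fin d → ℤ) : Prop where
  isUnit_det : IsUnit B.det
  length_pos : ∀ i, 0 < l i
  neighbors_eq : neighbors P (toReal v) = Set.range fun i => toReal (v + l i • B i)

theorem exists_smul_primitive {z : Fin d → ℤ} (hz : z ≠ 0) :
    ∃ n : ℤ, 0 < n ∧ z = n • primitive z := by
  refine ⟨Finset.univ.gcd z, lt_of_le_of_ne ?_ fun h => hz ?_, ?_⟩
  · exact Int.nonneg_of_normalize_eq_self Finset.normalize_gcd
  · ext i
    exact Finset.gcd_eq_zero_iff.1 h.symm i (Finset.mem_univ i)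
  · ext i
    exact (Int.mul_ediv_cancel' (Finset.gcd_dvd (Finset.mem_univ i))).symm

theorem IsSmoothPolytope.exists_isVertexFrame (hP : IsSmoothPolytope P) {v : Fin d → ℤ}
    (hv : toReal v ∈ vertices P) : ∃ B l, IsVertexFrame P v B l := by
  obtain ⟨w, -, hw, hdet⟩ := hP.2.2.2 v hv
  have hne : ∀ i, w i - v ≠ 0 := fun i h => by
    have : toReal (w i) ∈ neighbors P (toReal v) := hw ▸ ⟨i, rfl⟩
    exact this.2.1 (by rw [sub_eq_zero.1 h])
  choose l hl hl' using fun i => exists_smul_primitive (hne i)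
  refine ⟨Matrix.of fun i => primitive (w i - v), l, Int.isUnit_iff.2 hdet, hl, ?_⟩
  rw [← hw]
  congr 1
  ext1 i
  change toReal (w i) = toReal (v + l i • primitive (w i - v))
  rw [← hl' i, add_sub_cancel]

namespace IsVertexFrame

variable {v : Fin d → ℤ} {B : Matrix (Fin d) (Fin d) ℤ} {l : Fin d → ℤ}

theorem mem_neighbors (h : IsVertexFrame P v B l) (i : Fin d) :
    toReal (v + l i • B i) ∈ neighbors P (toReal v) := h.neighbors_eq ▸ ⟨i, rfl⟩

theorem add_smul_mem (h : IsVertexFrame P v B l) (i : Fin d) :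
    toReal (v + l i • B i) ∈ P := extremePoints_subset (h.mem_neighbors i).1

theorem row_ne_zero (h : IsVertexFrame P v B l) (i : Fin d) : B i ≠ 0 := by
  intro h0
  have := (h.mem_neighbors i).2.1
  rw [h0] at this
  simp at this

theorem add_mem (h : IsVertexFrame P v B l) (hP : IsPolytope P) (hv : toReal v ∈ vertices P)
    (i : Fin d) : toReal (v + B i) ∈ P := by
  have := toReal_add_zsmul_mem hP.convex (m := 1) zero_le_one (h.length_pos i)
    (extremePoints_subset hv) (h.add_smul_mem i)
  rwa [one_smul] at this

/-- In the coordinates of its frame at a vertex, the polytope lies in the positive orthant. -/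
theorem coord_nonneg (h : IsVertexFrame P v B l) (hP : IsPolytope P)
    (hv : toReal v ∈ vertices P) {A : Matrix (Fin d) (Fin d) ℤ} (hA : B * A = 1)
    {z : Fin d → ℤ} (hz : toReal z ∈ P) (i : Fin d) : 0 ≤ Matrix.vecMul (z - v) A i := by
  have key := hP.le_of_forall_neighbors_le hv (-coordFunctional A i) ?_ hz
  · simp only [LinearMap.neg_apply, coordFunctional_toReal, neg_le_neg_iff, Int.cast_le] at key
    rw [Matrix.sub_vecMul]
    exact sub_nonneg.2 key
  · rw [h.neighbors_eq]
    rintro _ ⟨k, rfl⟩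
    simp only [LinearMap.neg_apply, coordFunctional_toReal, neg_le_neg_iff, Int.cast_le]
    rw [Matrix.add_vecMul, Matrix.smul_vecMul, ← Matrix.mul_apply_eq_vecMul, hA]
    by_cases hki : k = i
    · subst hki
      simp [(h.length_pos k).le]
    · simp [Matrix.one_apply_ne hki]

end IsVertexFrame

end Lattice

/-! ### Frames at adjacent vertices -/

section Adjacent

variable {d : ℕ} {P : Set (Fin d → ℝ)}

/-- Two bases of `ℤ^d` (the rows of `B` and of `B'`) that share a vector up to sign and span the
same orthant modulo that vector agree modulo it up to order: a nonnegative integral matrix with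
nonnegative integral inverse is a permutation matrix. -/
theorem exists_row_eq_add_smul {B A B' A' : Matrix (Fin d) (Fin d) ℤ} (hA : B * A = 1)
    (hA' : B' * A' = 1) {j j' : Fin d} (hj : B' j' = -B j)
    (hC : ∀ k, k ≠ j' → ∀ i, i ≠ j → 0 ≤ (B' * A) k i)
    (hD : ∀ i, i ≠ j → ∀ k, k ≠ j' → 0 ≤ (B * A') i k) {k : Fin d} (hk : k ≠ j') :
    ∃ i, B' k = B i + (B' * A) k j • B j := by
  have hAB : A * B = 1 := mul_eq_one_comm.1 hA
  have hAB' : A' * B' = 1 := mul_eq_one_comm.1 hA'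
  set C := B' * A with hCdef
  set D := B * A' with hDdef
  have hCD : C * D = 1 := by
    rw [hCdef, hDdef, Matrix.mul_assoc, ← Matrix.mul_assoc A, hAB, Matrix.one_mul, hA']
  have hDC : D * C = 1 := mul_eq_one_comm.1 hCD
  have hCB : C * B = B' := by rw [hCdef, Matrix.mul_assoc, hAB, Matrix.mul_one]
  have hDj : D j = -(1 : Matrix (Fin d) (Fin d) ℤ) j' := by
    rw [← hA', hDdef, Matrix.mul_apply_eq_vecMul, Matrix.mul_apply_eq_vecMul, hj,
      Matrix.neg_vecMul, neg_neg]
  have hDj0 : ∀ m, m ≠ j' → D j m = 0 := fun m hm => by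
    rw [hDj, Pi.neg_apply, Matrix.one_apply_ne hm.symm, neg_zero]
  have hnn : ∀ m, m ≠ j' → ∀ i ∈ Finset.univ, 0 ≤ C k i * D i m := by
    intro m hm i _
    by_cases hi : i = j
    · rw [hi, hDj0 m hm, mul_zero]
    · exact mul_nonneg (hC k hk i hi) (hD i hi m hm)
  have hsum : ∀ m, ∑ i, C k i * D i m = (1 : Matrix (Fin d) (Fin d) ℤ) k m := fun m => by
    rw [← hCD, Matrix.mul_apply]
  have hsumk : ∑ i, C k i * D i k = 1 := by rw [hsum, Matrix.one_apply_eq]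
  obtain ⟨i₀, -, hi₀⟩ := Finset.exists_ne_zero_of_sum_ne_zero (hsumk.trans_ne one_ne_zero)
  have hi₀j : i₀ ≠ j := by
    rintro rfl
    exact hi₀ (by rw [hDj0 k hk, mul_zero])
  have hpos : 0 < C k i₀ * D i₀ k := lt_of_le_of_ne (hnn k hk i₀ (Finset.mem_univ _)) hi₀.symm
  have hle : C k i₀ * D i₀ k ≤ 1 :=
    hsumk ▸ Finset.single_le_sum (hnn k hk) (Finset.mem_univ i₀)
  have hone : C k i₀ = 1 :=
    Int.eq_one_of_mul_eq_one_right (hC k hk i₀ hi₀j) (le_antisymm hle hpos)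
  have hzero : ∀ i, i ≠ j → i ≠ i₀ → C k i = 0 := by
    intro i hij hii
    by_contra hne
    have hDi : ∀ m, m ≠ j' → D i m = 0 := by
      intro m hm
      have hz : C k i * D i m = 0 := by
        by_cases hmk : m = k
        · subst hmk
          have h2 : ∑ x ∈ {i₀, i}, C m x * D x m ≤ ∑ x, C m x * D x m :=
            Finset.sum_le_sum_of_subset_of_nonneg (Finset.subset_univ _)
              fun x hx _ => hnn m hm x hx
          rw [Finset.sum_pair hii.symm, hsumk] at h2
          have := hnn m hm i (Finset.mem_univ i)
          omega
        · have h0 := hsum m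
          rw [Matrix.one_apply_ne (Ne.symm hmk)] at h0
          exact (Finset.sum_eq_zero_iff_of_nonneg (hnn m hm)).1 h0 i (Finset.mem_univ i)
      exact (mul_eq_zero.1 hz).resolve_left hne
    -- the row `D i` is then a multiple of `D j`, so `D` is singular
    have hrow : D i = (-D i j') • D j := by
      ext m
      by_cases hm : m = j'
      · subst hm; simp [hDj]
      · simp [hDi m hm, hDj0 m hm]
    have h1 : (D * C) i i = (-D i j') * (D * C) j i := by
      rw [Matrix.mul_apply_eq_vecMul, hrow, Matrix.smul_vecMul, ← Matrix.mul_apply_eq_vecMul]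
      simp [hDj]
    rw [hDC, Matrix.one_apply_eq, Matrix.one_apply_ne hij.symm, mul_zero] at h1
    exact one_ne_zero h1
  refine ⟨i₀, ?_⟩
  rw [← hCB]
  ext m
  rw [Matrix.mul_apply, ← Finset.sum_subset (Finset.subset_univ {i₀, j}), Finset.sum_pair hi₀j,
    hone, one_mul]
  · simp
  · intro x _ hx
    simp only [Finset.mem_insert, Finset.mem_singleton, not_or] at hx
    rw [hzero x hx.2 hx.1, zero_mul]

variable {N : ℕ} {v : Fin d → ℤ} {B B' : Matrix (Fin d) (Fin d) ℤ} {l l' : Fin d → ℤ} {j : Fin d}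

theorem IsVertexFrame.length_le (h : IsVertexFrame P v B l) (hP : IsPolytope P)
    (hN : (latticePoints P).encard ≤ (N : ℕ∞)) (hv : toReal v ∈ vertices P) (i : Fin d) :
    l i ≤ N := by
  have := succ_le_of_segment hP.convex hN (h.length_pos i).le (h.row_ne_zero i)
    (extremePoints_subset hv) (h.add_smul_mem i)
  omega

/-- The frames at the two ends of an edge agree up to order and sign modulo the edge direction
`B j`, and the multiples of `B j` by which they differ are bounded by the number of lattice points:
the polytope contains a lattice segment parallel to the edge at lattice distance one from it, and
the length of this segment determines the multiple. -/
theorem IsVertexFrame.exists_row_eq (h : IsVertexFrame P v B l)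
    (h' : IsVertexFrame P (v + l j • B j) B' l') (hP : IsPolytope P)
    (hN : (latticePoints P).encard ≤ (N : ℕ∞)) (hv : toReal v ∈ vertices P) (k : Fin d) :
    B' k = -B j ∨ ∃ i, ∃ a : ℤ, |a| ≤ N ∧ B' k = B i + a • B j := by
  set w := v + l j • B j with hwdef
  have hw : toReal w ∈ vertices P := (h.mem_neighbors j).1
  have hvw : toReal v ∈ neighbors P (toReal w) := mem_neighbors_symm hv (h.mem_neighbors j)
  rw [h'.neighbors_eq] at hvw
  obtain ⟨j', hj'⟩ := hvw
  have hj' : w + l' j' • B' j' = v := toReal_injective hj'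
  have hlj : l j • B j = -(l' j' • B' j') := by
    rw [eq_neg_iff_add_eq_zero]
    apply add_left_cancel (a := v)
    rw [← add_assoc, ← hwdef, hj', add_zero]
  have hA : B * B⁻¹ = 1 := Matrix.mul_nonsing_inv B h.isUnit_det
  have hA' : B' * B'⁻¹ = 1 := Matrix.mul_nonsing_inv B' h'.isUnit_det
  -- the edge vector has the same lattice length in both bases
  have hlen : l j = l' j' := by
    apply Int.dvd_antisymm (h.length_pos j).le (h'.length_pos j').le
    · have e := congrFun (congrArg (fun z => Matrix.vecMul z B'⁻¹) hlj) j'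
      simp only [Matrix.smul_vecMul, Matrix.neg_vecMul, ← Matrix.mul_apply_eq_vecMul, hA',
        Pi.smul_apply, Pi.neg_apply, Matrix.one_apply_eq, smul_eq_mul, mul_one] at e
      exact ⟨-(B * B'⁻¹) j j', by rw [mul_neg, e, neg_neg]⟩
    · have e := congrFun (congrArg (fun z => Matrix.vecMul z B⁻¹) hlj) j
      simp only [Matrix.smul_vecMul, Matrix.neg_vecMul, ← Matrix.mul_apply_eq_vecMul, hA,
        Pi.smul_apply, Pi.neg_apply, Matrix.one_apply_eq, smul_eq_mul, mul_one] at e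
      exact ⟨-(B' * B⁻¹) j' j, by rw [mul_neg, e]⟩
  have hBj : B' j' = -B j := by
    rw [← hlen, ← smul_neg] at hlj
    rw [smul_right_injective _ (h.length_pos j).ne' hlj, neg_neg]
  by_cases hk : k = j'
  · exact Or.inl (hk ▸ hBj)
  right
  have hcoord : ∀ z : Fin d → ℤ, toReal (w + z) ∈ P → ∀ i,
      0 ≤ l j * (1 : Matrix (Fin d) (Fin d) ℤ) j i + Matrix.vecMul z B⁻¹ i := by
    intro z hz i
    have := h.coord_nonneg hP hv hA hz i
    rwa [hwdef, add_assoc, add_sub_cancel_left, Matrix.add_vecMul, Matrix.smul_vecMul,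
      ← Matrix.mul_apply_eq_vecMul, hA] at this
  have hC : ∀ k, k ≠ j' → ∀ i, i ≠ j → 0 ≤ (B' * B⁻¹) k i := by
    intro k _ i hi
    have := hcoord _ (h'.add_mem hP hw k) i
    rwa [Matrix.one_apply_ne hi.symm, mul_zero, zero_add, ← Matrix.mul_apply_eq_vecMul] at this
  have hD : ∀ i, i ≠ j → ∀ k, k ≠ j' → 0 ≤ (B * B'⁻¹) i k := by
    intro i _ k hk
    have := h'.coord_nonneg hP hw hA' (h.add_mem hP hv i) k
    rwa [show v + B i - w = l' j' • B' j' + B i by rw [← hj']; abel, Matrix.add_vecMul,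
      Matrix.smul_vecMul, ← Matrix.mul_apply_eq_vecMul, ← Matrix.mul_apply_eq_vecMul, hA',
      Pi.add_apply, Pi.smul_apply, Matrix.one_apply_ne hk.symm, smul_zero, zero_add] at this
  obtain ⟨i, hi⟩ := exists_row_eq_add_smul hA hA' hBj hC hD hk
  have hlow : 0 ≤ l j + (B' * B⁻¹) k j := by
    have := hcoord _ (h'.add_mem hP hw k) j
    rwa [Matrix.one_apply_eq, mul_one, ← Matrix.mul_apply_eq_vecMul] at this
  have hlN := h.length_le hP hN hv j
  have hseg : toReal (v + B i + (l j + (B' * B⁻¹) k j) • B j) ∈ P := by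
    have := h'.add_mem hP hw k
    rwa [hi, hwdef, show v + l j • B j + (B i + (B' * B⁻¹) k j • B j) =
      v + B i + (l j + (B' * B⁻¹) k j) • B j by rw [add_smul]; abel] at this
  have hup := succ_le_of_segment hP.convex hN hlow (h.row_ne_zero j) (h.add_mem hP hv i) hseg
  have hlpos := h.length_pos j
  exact ⟨i, _, abs_le.2 ⟨by omega, by omega⟩, hi⟩

end Adjacent

/-! ### Bounding a smooth polytope along edge paths -/

section Bound

variable {d : ℕ} {P : Set (Fin d → ℝ)} {N : ℕ}

theorem ncard_vertices_le (hP : IsLatticePolytope P)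
    (hN : (latticePoints P).encard ≤ (N : ℕ∞)) : (vertices P).ncard ≤ N := by
  have hsub : vertices P ⊆ latticePoints P := fun v hv => by
    obtain ⟨z, rfl⟩ := hP.2 v hv
    exact ⟨extremePoints_subset hv, z, rfl⟩
  have := (Set.encard_le_encard hsub).trans hN
  rw [← hP.1.finite_vertices.cast_ncard_eq] at this
  exact_mod_cast this

/-- A bound for a linear form `φ` on the displacement from `v` to `u`, in terms of its values on a
frame at `v`. The path from `v` to `u` follows edges along which `f`, whose maximum is attained
only at `u`, increases; its length is at most the number `n` of vertices at which `f` is larger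
than at `v`, and along each edge the bound on the frame grows by a factor of at most `1 + N`. -/
theorem abs_apply_sub_le (hP : IsSmoothPolytope P)
    (hN : (latticePoints P).encard ≤ (N : ℕ∞)) (φ : (Fin d → ℤ) →ₗ[ℤ] ℤ) {u : Fin d → ℤ}
    (hu : toReal u ∈ vertices P) {f : StrongDual ℝ (Fin d → ℝ)}
    (hf : ∀ x ∈ vertices P, x ≠ toReal u → f x < f (toReal u)) (n : ℕ) :
    ∀ (v : Fin d → ℤ) (B : Matrix (Fin d) (Fin d) ℤ) (l : Fin d → ℤ) (K : ℤ),
      toReal v ∈ vertices P → IsVertexFrame P v B l → 0 ≤ K → (∀ i, |φ (B i)| ≤ K) →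
      {x ∈ vertices P | f (toReal v) < f x}.ncard ≤ n →
      |φ (u - v)| ≤ K * ((1 + N) ^ n - 1) := by
  induction n with
  | zero =>
    intro v B l K hv _ _ _ hn
    have hfin : {x ∈ vertices P | f (toReal v) < f x}.Finite :=
      hP.1.1.finite_vertices.subset (Set.sep_subset _ _)
    have hemp := (Set.ncard_eq_zero hfin).1 (Nat.le_zero.1 hn)
    have huv : u = v := by
      by_contra hne
      have : toReal u ∈ {x ∈ vertices P | f (toReal v) < f x} :=
        ⟨hu, hf _ hv fun e => hne (toReal_injective e).symm⟩
      rw [hemp] at this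
      exact this
    simp [huv]
  | succ n ih =>
    intro v B l K hv h hK hB hn
    have hNnn : (0 : ℤ) ≤ N := Int.natCast_nonneg N
    have hpow : (1 : ℤ) ≤ (1 + N) ^ n := one_le_pow₀ (by omega)
    by_cases huv : u = v
    · have : (0 : ℤ) ≤ (1 + N) ^ (n + 1) - 1 := sub_nonneg.2 (one_le_pow₀ (by omega))
      simpa [huv] using mul_nonneg hK this
    have hlt : f (toReal v) < f (toReal u) := hf _ hv fun e => huv (toReal_injective e).symm
    obtain ⟨w, hw, hfw⟩ : ∃ w ∈ neighbors P (toReal v), f (toReal v) < f w := by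
      by_contra! hcon
      exact absurd (hP.1.1.le_of_forall_neighbors_le hv f.toLinearMap hcon
        (extremePoints_subset hu)) (not_le.2 hlt)
    rw [h.neighbors_eq] at hw
    obtain ⟨j, rfl⟩ := hw
    have hwv : toReal (v + l j • B j) ∈ vertices P := (h.mem_neighbors j).1
    obtain ⟨B', l', h'⟩ := hP.exists_isVertexFrame hwv
    have hcard : {x ∈ vertices P | f (toReal (v + l j • B j)) < f x}.ncard ≤ n := by
      have hss : {x ∈ vertices P | f (toReal (v + l j • B j)) < f x} ⊂
          {x ∈ vertices P | f (toReal v) < f x} := by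
        have hsub : {x ∈ vertices P | f (toReal (v + l j • B j)) < f x} ⊆
            {x ∈ vertices P | f (toReal v) < f x} := fun x hx => ⟨hx.1, hfw.trans hx.2⟩
        exact (Set.ssubset_iff_of_subset hsub).2
          ⟨toReal (v + l j • B j), ⟨hwv, hfw⟩, fun hx => lt_irrefl _ hx.2⟩
      have := Set.ncard_lt_ncard hss (hP.1.1.finite_vertices.subset (Set.sep_subset _ _))
      omega
    have hB' : ∀ k, |φ (B' k)| ≤ (1 + N) * K := by
      intro k
      rcases h.exists_row_eq h' hP.1.1 hN hv k with e | ⟨i, a, ha, e⟩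
      · rw [e, map_neg, abs_neg]
        nlinarith [hB j]
      · rw [e, map_add, map_smul, smul_eq_mul]
        calc |φ (B i) + a * φ (B j)| ≤ |φ (B i)| + |a| * |φ (B j)| := by
              rw [← abs_mul]; exact abs_add_le _ _
          _ ≤ K + N * K := add_le_add (hB i) (mul_le_mul ha (hB j) (abs_nonneg _) hNnn)
          _ = (1 + N) * K := by ring
    have hrec := ih _ B' l' _ hwv h' (by positivity) hB' hcard
    have hl := h.length_le hP.1.1 hN hv j
    have hl0 := h.length_pos j
    calc |φ (u - v)| = |φ (u - (v + l j • B j)) + l j * φ (B j)| := by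
          rw [← smul_eq_mul, ← map_smul, ← map_add]
          congr 2
          abel
      _ ≤ |φ (u - (v + l j • B j))| + l j * |φ (B j)| := by
          refine (abs_add_le _ _).trans_eq ?_
          rw [abs_mul, abs_of_pos hl0]
      _ ≤ (1 + N) * K * ((1 + N) ^ n - 1) + N * K :=
          add_le_add hrec (mul_le_mul hl (hB j) (abs_nonneg _) hNnn)
      _ = K * ((1 + N) ^ (n + 1) - 1) := by ring

theorem latticeMap_image_convexHull (U : GL (Fin d) ℤ) (t : Fin d → ℤ) (S : Set (Fin d → ℝ)) :
    latticeMap U t '' convexHull ℝ S = convexHull ℝ (latticeMap U t '' S) := by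
  let F : (Fin d → ℝ) →ᵃ[ℝ] (Fin d → ℝ) :=
    (Matrix.mulVecLin ((U : Matrix (Fin d) (Fin d) ℤ).map (Int.cast : ℤ → ℝ))).toAffineMap +
      AffineMap.const ℝ _ (toReal t)
  exact F.image_convexHull S

theorem latticeMap_toReal (U : GL (Fin d) ℤ) (t z : Fin d → ℤ) :
    latticeMap U t (toReal z) =
      toReal (Matrix.mulVec (U : Matrix (Fin d) (Fin d) ℤ) z + t) := by
  ext i
  simp [latticeMap, toReal, Matrix.mulVec, dotProduct]

/-- A smooth polytope is lattice equivalent to the convex hull of lattice points in a box whose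
size depends only on the number of its lattice points. -/
theorem exists_latticeEquivalent_convexHull (hP : IsSmoothPolytope P)
    (hN : (latticePoints P).encard ≤ (N : ℕ∞)) :
    ∃ T ⊆ Set.Icc (fun _ => -((1 + N) ^ N - 1) : Fin d → ℤ) (fun _ => (1 + N) ^ N - 1),
      LatticeEquivalent (convexHull ℝ (toReal '' T)) P := by
  have hne : P.Nonempty := by
    rw [Set.nonempty_iff_ne_empty]
    rintro rfl
    have := hP.2.1
    rw [AffineSubspace.span_empty] at this
    exact AffineSubspace.bot_ne_top ℝ (Fin d → ℝ) (Fin d → ℝ) this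
  obtain ⟨x, hx⟩ := hP.1.1.isCompact.extremePoints_nonempty hne
  obtain ⟨v, rfl⟩ := hP.1.2 x hx
  obtain ⟨B, l, h⟩ := hP.exists_isVertexFrame hx
  have hA : B * B⁻¹ = 1 := Matrix.mul_nonsing_inv B h.isUnit_det
  have hA' : B⁻¹ * B = 1 := Matrix.nonsing_inv_mul B h.isUnit_det
  let U : GL (Fin d) ℤ := Matrix.GeneralLinearGroup.mk'' B.transpose (by simpa using h.isUnit_det)
  have hU : ∀ c, latticeMap U v (toReal c) = toReal (Matrix.vecMul c B + v) := fun c => by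
    rw [latticeMap_toReal]
    congr 2
    exact Matrix.mulVec_transpose B c
  refine ⟨{c | toReal (Matrix.vecMul c B + v) ∈ vertices P}, ?_, U, v, ?_⟩
  · intro c hc
    suffices hb : ∀ i, |c i| ≤ (1 + N) ^ N - 1 from
      ⟨fun i => (abs_le.1 (hb i)).1, fun i => (abs_le.1 (hb i)).2⟩
    intro i
    obtain ⟨f, hf⟩ := hP.1.1.exists_forall_lt hc
    have hcard : {x ∈ vertices P | f (toReal v) < f x}.ncard ≤ N :=
      (Set.ncard_le_ncard (Set.sep_subset _ _) hP.1.1.finite_vertices).trans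
        (ncard_vertices_le hP.1 hN)
    have key := abs_apply_sub_le hP hN (LinearMap.proj i ∘ₗ B⁻¹.vecMulLinear) hc hf N v B l 1 hx h
      zero_le_one ?_ hcard
    · simpa [hA] using key
    · intro k
      simp only [LinearMap.comp_apply, Matrix.vecMulLinear_apply, LinearMap.proj_apply]
      rw [← Matrix.mul_apply_eq_vecMul, hA, Matrix.one_apply]
      split_ifs <;> simp
  · rw [latticeMap_image_convexHull, Set.image_image]
    simp only [hU]
    rw [← hP.1.1.convexHull_vertices]
    congr 1
    rw [hP.1.1.convexHull_vertices]
    ext y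
    constructor
    · intro hy
      obtain ⟨z, rfl⟩ := hP.1.2 y hy
      have hz : Matrix.vecMul (Matrix.vecMul (z - v) B⁻¹) B + v = z := by
        rw [Matrix.vecMul_vecMul, hA', Matrix.vecMul_one, sub_add_cancel]
      exact ⟨Matrix.vecMul (z - v) B⁻¹, by simpa only [Set.mem_ofPred_eq, hz] using hy,
        congrArg toReal hz⟩
    · rintro ⟨c, hc, rfl⟩
      exact hc

end Bound

end SmoothPolytope

theorem mainTheorem1 (d N : ℕ) :
    (Quotient.mk (SmoothPolytope.latticeSetoid d) ''
      {P : Set (Fin d → ℝ) | SmoothPolytope.IsSmoothPolytope P ∧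
        (SmoothPolytope.latticePoints P).encard ≤ (N : ℕ∞)}).Finite := by
  refine ((Set.finite_Icc (fun _ => -((1 + N) ^ N - 1) : Fin d → ℤ)
    (fun _ => (1 + N) ^ N - 1)).finite_subsets.image fun T =>
      Quotient.mk (SmoothPolytope.latticeSetoid d)
        (convexHull ℝ (SmoothPolytope.toReal '' T))).subset ?_
  rintro _ ⟨P, ⟨hP, hN⟩, rfl⟩
  obtain ⟨T, hT, hTP⟩ := SmoothPolytope.exists_latticeEquivalent_convexHull hP hN
  exact ⟨T, hT, Quotient.sound hTP⟩
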